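/- For an integer $k \ge 0$ let $r_k = 1$ if the number of (possibly overlapping) $11$-blocks in the base $2$ representation of $k$ is even, and $r_k = -1$ otherwise (the Rudin–Shapiro sequence). Let $(a_n)_{n \ge 1} = (0, 1, 2, 4, 5, 7, \ldots)$ be the indices $k$ with $r_k = 1$, sorted in increasing order (the Rudin–Shapiro integers). For a finite set $A$ of integers let $$E(A) = \#\{(x_1, x_2, x_3, x_4) \in A^4 : x_1 - x_2 = x_3 - x_4\}$$ be its additive energy. For real $\alpha$ and $N \ge 1$ let $$D_N^* = D_N^*(\alpha) = \sup_{0 < \beta \le 1} \left| \frac{\#\{1 \le n \le N : \{a_n \alpha\} \in [0, \beta)\}}{N} - \beta \right|$$ be the star-discrepancy of the first $N$ terms of the sequence $(\{a_n \alpha\})_{n \ge 1}$ of fractional parts. Then: (i) $E(\{a_1, \ldots, a_N\}) \gg N^3$, that is, there is a constant $c > 0$ such that $E(\{a_1, \ldots, a_N\}) \ge c N^3$ for all $N \ge 1$; (ii) for almost all real $\alpha$ (with respect to Lebesgue measure), $N D_N^* = \Omega(N^{1/2 - \varepsilon})$ for all $\varepsilon > 0$, that is, for every $\varepsilon > 0$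 there is a constant $c > 0$ such that $N D_N^* \ge c N^{1/2 - \varepsilon}$ for infinitely many $N$. -/

import Mathlib

open Filter MeasureTheory

/-- The number of (possibly overlapping) `11`-blocks in the base `2` representation of `k`, that is,
the number of positions `i` such that the binary digits of `k` at `i` and `i + 1` are both `1`.
(A nonzero binary digit of `k` can only stand at a position `i` with `2 ^ i ≤ k`, so that `i < k`.) -/
def blockCount (k : ℕ) : ℕ :=
  ((Finset.range k).filter (fun i => k.testBit i = true ∧ k.testBit (i + 1) = true)).card

/-- The Rudin-Shapiro sequence `r_0, r_1, r_2, … = 1, 1, 1, -1, 1, 1, -1, 1, …`. -/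
def rudinShapiro (k : ℕ) : ℤ :=
  if Even (blockCount k) then 1 else -1

/-- The Rudin-Shapiro integers, i.e. the indices `k` with `r_k = 1` in increasing order, counted from
index `0`: `rudinShapiroInteger n` is `a_{n+1}`. There are infinitely many such `k`
(see `infinite_rudinShapiro`). -/
noncomputable def rudinShapiroInteger (n : ℕ) : ℕ :=
  Nat.nth (fun k => rudinShapiro k = 1) n

theorem infinite_rudinShapiro : {k : ℕ | rudinShapiro k = 1}.Infinite := by
  refine Set.infinite_of_injective_forall_mem (f := fun m : ℕ => 2 ^ m)
    (Nat.pow_right_injective le_rfl) ?_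
  intro m
  have h : blockCount (2 ^ m) = 0 := by
    unfold blockCount
    rw [Finset.card_eq_zero, Finset.filter_eq_empty_iff]
    intro i _ hi
    simp only [Nat.testBit_two_pow, decide_eq_true_eq] at hi
    omega
  simp [rudinShapiro, h]

/-- The set `{a_1, …, a_N}` of the first `N` Rudin-Shapiro integers. -/
noncomputable def firstRudinShapiroIntegers (N : ℕ) : Finset ℕ :=
  (Finset.range N).image rudinShapiroInteger

/-- The star-discrepancy `D_N^*` of the first `N` terms `x 0, …, x (N - 1)` of a sequence in `[0, 1)`:
the supremum over `0 < β ≤ 1` of `|#{n < N : x n ∈ [0, β)} / N - β|`. -/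
noncomputable def starDiscrepancy (x : ℕ → ℝ) (N : ℕ) : ℝ :=
  ⨆ β : Set.Ioc (0 : ℝ) 1,
    |(Nat.card {n : ℕ // n < N ∧ x n ∈ Set.Ico (0 : ℝ) β} : ℝ) / N - β|

/-- `f = Ω(g)`: there is `c > 0` such that `|f N| ≥ c |g N|` for infinitely many `N`. -/
def IsBigOmega (f g : ℕ → ℝ) : Prop :=
  ∃ c : ℝ, 0 < c ∧ ∃ᶠ N in atTop, c * |g N| ≤ |f N|

theorem blockCount_eq_sum {k M : ℕ} (h : k ≤ M) :
    blockCount k = ∑ i ∈ Finset.range M,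
      if k.testBit i = true ∧ k.testBit (i + 1) = true then 1 else 0 := by
  rw [blockCount, Finset.card_filter]
  refine Finset.sum_subset (Finset.range_mono h) fun i _ hi => ?_
  have hki : k.testBit i = false := Nat.testBit_lt_two_pow <|
    (not_lt.1 (mt Finset.mem_range.2 hi)).trans_lt Nat.lt_two_pow_self
  simp [hki]

theorem blockCount_two_mul (k : ℕ) : blockCount (2 * k) = blockCount k := by
  rw [blockCount_eq_sum (show 2 * k ≤ 2 * k + 1 by omega),
    blockCount_eq_sum (show k ≤ 2 * k by omega), Finset.sum_range_succ']
  simp [Nat.testBit_succ]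

theorem blockCount_two_mul_add_one (k : ℕ) : blockCount (2 * k + 1) = blockCount k + k % 2 := by
  rw [blockCount_eq_sum (show 2 * k + 1 ≤ 2 * k + 1 by omega),
    blockCount_eq_sum (show k ≤ 2 * k by omega), Finset.sum_range_succ']
  have h : (2 * k + 1) / 2 = k := by omega
  simp only [Nat.testBit_succ, h, Nat.testBit_zero]
  rcases Nat.mod_two_eq_zero_or_one k with hk | hk <;> simp [hk]

theorem rudinShapiro_eq_neg_one_pow (k : ℕ) : rudinShapiro k = (-1) ^ blockCount k := by
  unfold rudinShapiro
  split_ifs with h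
  · exact h.neg_one_pow.symm
  · exact (Nat.not_even_iff_odd.1 h).neg_one_pow.symm

theorem rudinShapiro_two_mul (k : ℕ) : rudinShapiro (2 * k) = rudinShapiro k := by
  simp only [rudinShapiro_eq_neg_one_pow, blockCount_two_mul]

theorem rudinShapiro_two_mul_add_one (k : ℕ) :
    rudinShapiro (2 * k + 1) = rudinShapiro k * (-1) ^ (k % 2) := by
  simp only [rudinShapiro_eq_neg_one_pow, blockCount_two_mul_add_one, pow_add]

theorem rudinShapiro_eq_one_or (k : ℕ) : rudinShapiro k = 1 ∨ rudinShapiro k = -1 := by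
  unfold rudinShapiro
  split_ifs <;> simp

theorem rudinShapiro_two_pow_succ_add (m : ℕ) :
    ∀ k < 2 ^ m, rudinShapiro (2 ^ (m + 1) + k) = rudinShapiro k := by
  induction m with
  | zero =>
    intro k hk
    obtain rfl : k = 0 := by simpa using hk
    decide
  | succ m ih =>
    intro k hk
    have hj : k / 2 < 2 ^ m := by rw [pow_succ] at hk; omega
    have hpar : (2 ^ (m + 1) + k / 2) % 2 = k / 2 % 2 := by rw [pow_succ]; omega
    rcases Nat.mod_two_eq_zero_or_one k with h | h
    · have h1 : 2 ^ (m + 1 + 1) + k = 2 * (2 ^ (m + 1) + k / 2) := by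
        rw [pow_succ 2 (m + 1)]; omega
      have h2 : rudinShapiro k = rudinShapiro (2 * (k / 2)) := by congr 1; omega
      rw [h1, h2, rudinShapiro_two_mul, rudinShapiro_two_mul, ih _ hj]
    · have h1 : 2 ^ (m + 1 + 1) + k = 2 * (2 ^ (m + 1) + k / 2) + 1 := by
        rw [pow_succ 2 (m + 1)]; omega
      have h2 : rudinShapiro k = rudinShapiro (2 * (k / 2) + 1) := by congr 1; omega
      rw [h1, h2, rudinShapiro_two_mul_add_one, rudinShapiro_two_mul_add_one, ih _ hj, hpar]

theorem rudinShapiro_two_pow_succ_add_two_pow_add (m : ℕ) :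
    ∀ k < 2 ^ m, rudinShapiro (2 ^ (m + 1) + (2 ^ m + k)) = -rudinShapiro (2 ^ m + k) := by
  induction m with
  | zero =>
    intro k hk
    obtain rfl : k = 0 := by simpa using hk
    decide
  | succ m ih =>
    intro k hk
    have hj : k / 2 < 2 ^ m := by rw [pow_succ] at hk; omega
    have hpar : (2 ^ (m + 1) + (2 ^ m + k / 2)) % 2 = (2 ^ m + k / 2) % 2 := by
      rw [pow_succ]; omega
    rcases Nat.mod_two_eq_zero_or_one k with h | h
    · have h1 : 2 ^ (m + 1 + 1) + (2 ^ (m + 1) + k)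
          = 2 * (2 ^ (m + 1) + (2 ^ m + k / 2)) := by
        rw [pow_succ 2 (m + 1), pow_succ 2 m]; omega
      have h2 : 2 ^ (m + 1) + k = 2 * (2 ^ m + k / 2) := by rw [pow_succ 2 m]; omega
      rw [h1, h2, rudinShapiro_two_mul, rudinShapiro_two_mul, ih _ hj]
    · have h1 : 2 ^ (m + 1 + 1) + (2 ^ (m + 1) + k)
          = 2 * (2 ^ (m + 1) + (2 ^ m + k / 2)) + 1 := by
        rw [pow_succ 2 (m + 1), pow_succ 2 m]; omega
      have h2 : 2 ^ (m + 1) + k = 2 * (2 ^ m + k / 2) + 1 := by rw [pow_succ 2 m]; omega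
      rw [h1, h2, rudinShapiro_two_mul_add_one, rudinShapiro_two_mul_add_one, ih _ hj, hpar,
        neg_mul]

/-- The Rudin-Shapiro polynomial with `M` terms, evaluated at `z`. -/
noncomputable def rudinShapiroSum (z : ℂ) (M : ℕ) : ℂ :=
  ∑ k ∈ Finset.range M, (rudinShapiro k : ℂ) * z ^ k

/-- The companion of the `m`-th Rudin-Shapiro polynomial, evaluated at `z`. -/
noncomputable def rudinShapiroCompanion (z : ℂ) (m : ℕ) : ℂ :=
  ∑ k ∈ Finset.range (2 ^ m), (rudinShapiro (2 ^ m + k) : ℂ) * z ^ k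

theorem rudinShapiroSum_two_pow_succ (z : ℂ) (m : ℕ) :
    rudinShapiroSum z (2 ^ (m + 1))
      = rudinShapiroSum z (2 ^ m) + z ^ 2 ^ m * rudinShapiroCompanion z m := by
  rw [rudinShapiroSum, pow_succ, mul_two, Finset.sum_range_add, rudinShapiroSum,
    rudinShapiroCompanion, Finset.mul_sum]
  congr 1
  exact Finset.sum_congr rfl fun k _ => by rw [pow_add]; ring

theorem rudinShapiroCompanion_succ (z : ℂ) (m : ℕ) :
    rudinShapiroCompanion z (m + 1)
      = rudinShapiroSum z (2 ^ m) - z ^ 2 ^ m * rudinShapiroCompanion z m := by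
  have h : Finset.range (2 ^ (m + 1)) = Finset.range (2 ^ m + 2 ^ m) := by rw [pow_succ, mul_two]
  rw [rudinShapiroCompanion, h, Finset.sum_range_add, rudinShapiroSum,
    rudinShapiroCompanion, Finset.mul_sum, sub_eq_add_neg, ← Finset.sum_neg_distrib]
  congr 1
  · refine Finset.sum_congr rfl fun k hk => ?_
    rw [rudinShapiro_two_pow_succ_add m k (Finset.mem_range.1 hk)]
  · refine Finset.sum_congr rfl fun k hk => ?_
    rw [rudinShapiro_two_pow_succ_add_two_pow_add m k (Finset.mem_range.1 hk), pow_add]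
    push_cast
    ring

theorem norm_sq_rudinShapiroSum_add_norm_sq_companion {z : ℂ} (hz : ‖z‖ = 1) (m : ℕ) :
    ‖rudinShapiroSum z (2 ^ m)‖ ^ 2 + ‖rudinShapiroCompanion z m‖ ^ 2 = 2 ^ (m + 1) := by
  induction m with
  | zero =>
    have h0 : rudinShapiro 0 = 1 := by decide
    have h1 : rudinShapiro 1 = 1 := by decide
    norm_num [rudinShapiroSum, rudinShapiroCompanion, h0, h1]
  | succ m ih =>
    rw [rudinShapiroSum_two_pow_succ, rudinShapiroCompanion_succ, parallelogram_law_with_norm ℝ,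
      norm_mul, norm_pow, hz, one_pow, one_mul, ih]
    ring

theorem exists_sqrt_le_norm_rudinShapiroSum {z : ℂ} (hz : ‖z‖ = 1) (m : ℕ) :
    ∃ M : ℕ, 2 ^ m ≤ M ∧ √(M : ℝ) / 4 ≤ ‖rudinShapiroSum z M‖ := by
  have h := norm_sq_rudinShapiroSum_add_norm_sq_companion hz m
  have hQ : ‖rudinShapiroCompanion z m‖
      ≤ ‖rudinShapiroSum z (2 ^ (m + 1))‖ + ‖rudinShapiroSum z (2 ^ m)‖ := by
    have h1 : ‖z ^ 2 ^ m * rudinShapiroCompanion z m‖ = ‖rudinShapiroCompanion z m‖ := by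
      rw [norm_mul, norm_pow, hz, one_pow, one_mul]
    rw [← h1, ← add_sub_cancel_left (rudinShapiroSum z (2 ^ m)) (z ^ 2 ^ m * _),
      ← rudinShapiroSum_two_pow_succ]
    exact norm_sub_le _ _
  set a := ‖rudinShapiroSum z (2 ^ m)‖ with ha
  set b := ‖rudinShapiroSum z (2 ^ (m + 1))‖ with hb
  have ha0 : 0 ≤ a := norm_nonneg _
  have hb0 : 0 ≤ b := norm_nonneg _
  have hpos : (0 : ℝ) < 2 ^ m := by positivity
  by_cases hc : √((2 ^ m : ℕ) : ℝ) / 4 ≤ a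
  · exact ⟨2 ^ m, le_rfl, hc⟩
  by_cases hd : √((2 ^ (m + 1) : ℕ) : ℝ) / 4 ≤ b
  · exact ⟨2 ^ (m + 1), Nat.pow_le_pow_right two_pos m.le_succ, hd⟩
  exfalso
  have ha2 : a ^ 2 ≤ 2 ^ m / 16 := by
    have hs := Real.sq_sqrt (show (0 : ℝ) ≤ (2 ^ m : ℕ) by positivity)
    push_cast at hs hc
    nlinarith
  have hb2 : b ^ 2 ≤ 2 ^ m / 8 := by
    have hs := Real.sq_sqrt (show (0 : ℝ) ≤ (2 ^ (m + 1) : ℕ) by positivity)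
    push_cast at hs hd
    have hs' : √(2 ^ (m + 1) : ℝ) ^ 2 = 2 ^ m * 2 := by rw [hs, pow_succ]
    nlinarith
  have hQ2 : ‖rudinShapiroCompanion z m‖ ^ 2 ≤ (b + a) ^ 2 :=
    pow_le_pow_left₀ (norm_nonneg _) hQ 2
  rw [pow_succ (2 : ℝ)] at h
  nlinarith [sq_nonneg (a - b)]

theorem norm_geom_sum_le {z : ℂ} (hz : ‖z‖ = 1) (hz1 : z ≠ 1) (M : ℕ) :
    ‖∑ k ∈ Finset.range M, z ^ k‖ ≤ 2 / ‖z - 1‖ := by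
  rw [geom_sum_eq hz1, norm_div]
  gcongr
  calc ‖z ^ M - 1‖ ≤ ‖z ^ M‖ + ‖(1 : ℂ)‖ := norm_sub_le _ _
    _ = 2 := by rw [norm_pow, hz]; norm_num

theorem le_count_rudinShapiro (m : ℕ) : m ≤ Nat.count (fun k => rudinShapiro k = 1) (4 * m) := by
  induction m with
  | zero => simp
  | succ m ih =>
    have h : rudinShapiro (4 * m + 3) = -rudinShapiro (4 * m + 2) := by
      have h1 : 4 * m + 3 = 2 * (2 * m + 1) + 1 := by ring
      have h2 : 4 * m + 2 = 2 * (2 * m + 1) := by ring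
      have h3 : (2 * m + 1) % 2 = 1 := by omega
      rw [h1, h2, rudinShapiro_two_mul_add_one, rudinShapiro_two_mul, h3, pow_one, mul_neg_one]
    rw [show 4 * (m + 1) = 4 * m + 1 + 1 + 1 + 1 by ring]
    simp only [Nat.count_succ]
    rw [show 4 * m + 1 + 1 = 4 * m + 2 by ring, show 4 * m + 2 + 1 = 4 * m + 3 by ring, h]
    rcases rudinShapiro_eq_one_or (4 * m + 2) with h2 | h2 <;> simp only [h2] <;> norm_num <;> omega

theorem rudinShapiroInteger_lt (n : ℕ) : rudinShapiroInteger n < 4 * (n + 1) :=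
  Nat.nth_lt_of_lt_count (le_count_rudinShapiro (n + 1))

theorem sum_rudinShapiroInteger {E : Type*} [AddCommMonoid E] (f : ℕ → E) (M : ℕ) :
    ∑ n ∈ Finset.range (Nat.count (fun k => rudinShapiro k = 1) M), f (rudinShapiroInteger n)
      = ∑ k ∈ Finset.range M, if rudinShapiro k = 1 then f k else 0 := by
  induction M with
  | zero => simp
  | succ M ih =>
    rw [Nat.count_succ, Finset.sum_range_succ _ M, ← ih]
    split_ifs with h
    · rw [Finset.sum_range_succ, rudinShapiroInteger,
        Nat.nth_count (p := fun k => rudinShapiro k = 1) h]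
    · rw [add_zero, add_zero]

theorem card_firstRudinShapiroIntegers (N : ℕ) : (firstRudinShapiroIntegers N).card = N := by
  have h : Function.Injective rudinShapiroInteger := Nat.nth_injective infinite_rudinShapiro
  rw [firstRudinShapiroIntegers, Finset.card_image_of_injective _ h, Finset.card_range]

theorem pow_three_le_addEnergy_firstRudinShapiroIntegers {N : ℕ} (hN : 1 ≤ N) :
    N ^ 3 ≤ 8 * Finset.addEnergy (firstRudinShapiroIntegers N) (firstRudinShapiroIntegers N) := by
  have h := Finset.card_sq_le_card_mul_addEnergy (firstRudinShapiroIntegers N)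
    (firstRudinShapiroIntegers N) (Finset.range (8 * N))
  have hlt : ∀ x ∈ firstRudinShapiroIntegers N, x < 4 * N := by
    intro x hx
    obtain ⟨n, hn, rfl⟩ := Finset.mem_image.1 hx
    have := rudinShapiroInteger_lt n
    have := Finset.mem_range.1 hn
    omega
  rw [Finset.filter_true_of_mem, Finset.card_product, card_firstRudinShapiroIntegers,
    Finset.card_range] at h
  · refine Nat.le_of_mul_le_mul_left ?_ hN
    linarith
  · intro xy hxy
    have := hlt _ (Finset.mem_product.1 hxy).1
    have := hlt _ (Finset.mem_product.1 hxy).2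
    exact Finset.mem_range.2 (by omega)

theorem bddAbove_range_discrepancy (x : ℕ → ℝ) (N : ℕ) :
    BddAbove (Set.range fun β : Set.Ioc (0 : ℝ) 1 =>
      |(Nat.card {n : ℕ // n < N ∧ x n ∈ Set.Ico (0 : ℝ) β} : ℝ) / N - β|) := by
  refine ⟨1, ?_⟩
  rintro _ ⟨⟨β, hβ0, hβ1⟩, rfl⟩
  have hcard : Nat.card {n : ℕ // n < N ∧ x n ∈ Set.Ico (0 : ℝ) β} ≤ N := by
    have h := Nat.card_mono (Set.finite_Iio N)
      (show {n : ℕ | n < N ∧ x n ∈ Set.Ico (0 : ℝ) β} ⊆ Set.Iio N from fun n hn => hn.1)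
    rwa [Nat.card_coe_set_eq (Set.Iio N), Set.ncard_Iio_nat] at h
  have h1 : (Nat.card {n : ℕ // n < N ∧ x n ∈ Set.Ico (0 : ℝ) β} : ℝ) / N ≤ 1 :=
    div_le_one_of_le₀ (by exact_mod_cast hcard) (by positivity)
  have h0 : 0 ≤ (Nat.card {n : ℕ // n < N ∧ x n ∈ Set.Ico (0 : ℝ) β} : ℝ) / N := by positivity
  exact abs_le.2 ⟨by dsimp only; linarith, by dsimp only; linarith⟩

theorem abs_card_sub_le_mul_starDiscrepancy {x : ℕ → ℝ} (hx : ∀ n, 0 ≤ x n) (N : ℕ) {t : ℝ}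
    (ht : t ∈ Set.Ioc (0 : ℝ) 1) :
    |(((Finset.range N).filter fun n => x n < t).card : ℝ) - N * t| ≤ N * starDiscrepancy x N := by
  rcases Nat.eq_zero_or_pos N with rfl | hN
  · simp
  have hN' : (0 : ℝ) < N := by exact_mod_cast hN
  have hcard : Nat.card {n : ℕ // n < N ∧ x n ∈ Set.Ico (0 : ℝ) t}
      = ((Finset.range N).filter fun n => x n < t).card := by
    rw [← Nat.card_eq_finsetCard]
    exact Nat.card_congr (Equiv.subtypeEquivRight fun n => by simp [hx n])
  have h := le_ciSup (bddAbove_range_discrepancy x N) ⟨t, ht⟩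
  rw [← starDiscrepancy] at h
  dsimp only at h
  rw [hcard] at h
  calc _ = N * |(((Finset.range N).filter fun n => x n < t).card : ℝ) / N - t| := by
        rw [← abs_of_pos hN', ← abs_mul, abs_of_pos hN', mul_sub, mul_div_cancel₀ _ hN'.ne']
    _ ≤ _ := by gcongr

/-- Koksma's inequality for the character `t ↦ exp (2 π i t)`. -/
theorem norm_sum_exp_le_mul_starDiscrepancy {x : ℕ → ℝ} (hx0 : ∀ n, 0 ≤ x n) (hx1 : ∀ n, x n ≤ 1)
    (N : ℕ) :
    ‖∑ n ∈ Finset.range N, Complex.exp (2 * Real.pi * Complex.I * x n)‖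
      ≤ 2 * Real.pi * (N * starDiscrepancy x N) := by
  set c : ℂ := 2 * Real.pi * Complex.I with hc
  set e' : ℝ → ℂ := fun t => c * Complex.exp (c * t) with he'
  have hc0 : c ≠ 0 := Complex.two_pi_I_ne_zero
  have hcont : Continuous e' := by fun_prop
  have hder : ∀ t : ℝ, HasDerivAt (fun t : ℝ => Complex.exp (c * t)) (e' t) t := by
    intro t
    have h1 : HasDerivAt (fun s : ℝ => c * (s : ℂ)) c t := by
      simpa using (Complex.ofRealCLM.hasDerivAt (x := t)).const_mul c
    rw [he']
    simpa only [mul_comm] using h1.cexp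
  have hexp1 : Complex.exp c = 1 := Complex.exp_two_pi_mul_I
  have hterm : ∀ n, ∫ t in (0 : ℝ)..1, (Set.Ioi (x n)).indicator e' t
      = 1 - Complex.exp (c * x n) := by
    intro n
    rw [intervalIntegral.integral_of_le zero_le_one, setIntegral_indicator measurableSet_Ioi,
      show Set.Ioc (0 : ℝ) 1 ∩ Set.Ioi (x n) = Set.Ioc (x n) 1 by
        ext t; constructor
        · rintro ⟨⟨_, h1⟩, h2⟩; exact ⟨h2, h1⟩
        · rintro ⟨h2, h1⟩; exact ⟨⟨(hx0 n).trans_lt h2, h1⟩, h2⟩,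
      ← intervalIntegral.integral_of_le (hx1 n),
      intervalIntegral.integral_eq_sub_of_hasDerivAt (fun t _ => hder t)
        (hcont.intervalIntegrable _ _)]
    simp [hexp1]
  have hlin : ∫ t in (0 : ℝ)..1, (t : ℂ) * e' t = 1 := by
    have hd : ∀ t : ℝ, HasDerivAt (fun t : ℝ => (t : ℂ) * Complex.exp (c * t)
        - Complex.exp (c * t) / c) ((t : ℂ) * e' t) t := by
      intro t
      have h1 : HasDerivAt (fun s : ℝ => (s : ℂ)) 1 t := Complex.ofRealCLM.hasDerivAt
      have h2 : e' t / c = Complex.exp (c * t) := mul_div_cancel_left₀ _ hc0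
      exact ((h1.mul (hder t)).sub ((hder t).div_const c)).congr_deriv (by rw [h2]; ring)
    rw [intervalIntegral.integral_eq_sub_of_hasDerivAt (fun t _ => hd t)
      ((by fun_prop : Continuous fun t : ℝ => (t : ℂ) * e' t).intervalIntegrable _ _)]
    simp [hexp1]
  have hint : ∀ n, IntervalIntegrable ((Set.Ioi (x n)).indicator e') volume 0 1 := by
    intro n
    have := (hcont.intervalIntegrable (μ := volume) 0 1)
    rw [intervalIntegrable_iff] at this ⊢
    exact this.indicator measurableSet_Ioi
  have key : ∑ n ∈ Finset.range N, Complex.exp (c * x n)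
      = -∫ t in (0 : ℝ)..1, (∑ n ∈ Finset.range N, (Set.Ioi (x n)).indicator e' t
          - N * ((t : ℂ) * e' t)) := by
    rw [intervalIntegral.integral_sub
      (by
        have := IntervalIntegrable.sum (Finset.range N) (fun n _ => hint n)
        exact this.congr fun t _ => by simp)
      ((by fun_prop : Continuous fun t : ℝ => (N : ℂ) * ((t : ℂ) * e' t)).intervalIntegrable _ _),
      intervalIntegral.integral_finsetSum (fun n _ => hint n),
      intervalIntegral.integral_const_mul, hlin]
    simp [hterm]
  rw [key, norm_neg]
  refine (intervalIntegral.norm_integral_le_of_norm_le_const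
    (C := 2 * Real.pi * (N * starDiscrepancy x N)) fun t ht => ?_).trans_eq (by simp)
  rw [Set.uIoc_of_le zero_le_one] at ht
  have hsum : ∑ n ∈ Finset.range N, (Set.Ioi (x n)).indicator e' t
      - N * ((t : ℂ) * e' t)
      = ((((Finset.range N).filter fun n => x n < t).card - N * t : ℝ) : ℂ) * e' t := by
    simp only [Set.indicator_apply, Set.mem_Ioi, ← Finset.sum_filter, Finset.sum_const,
      nsmul_eq_mul]
    push_cast
    ring
  have hnorm : ‖e' t‖ = 2 * Real.pi := by
    have h1 : c * t = ((2 * Real.pi * t : ℝ) : ℂ) * Complex.I := by rw [hc]; push_cast; ring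
    simp only [he']
    rw [norm_mul, h1, Complex.norm_exp_ofReal_mul_I, hc]
    simp [abs_of_pos Real.pi_pos]
  rw [hsum, norm_mul, hnorm, Complex.norm_real, Real.norm_eq_abs, mul_comm]
  gcongr
  exact abs_card_sub_le_mul_starDiscrepancy hx0 N ht

theorem sum_pow_rudinShapiroInteger (z : ℂ) (M : ℕ) :
    ∑ n ∈ Finset.range (Nat.count (fun k => rudinShapiro k = 1) M), z ^ rudinShapiroInteger n
      = (∑ k ∈ Finset.range M, z ^ k + rudinShapiroSum z M) / 2 := by
  rw [sum_rudinShapiroInteger (fun k => z ^ k), rudinShapiroSum, ← Finset.sum_add_distrib,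
    Finset.sum_div]
  refine Finset.sum_congr rfl fun k _ => ?_
  rcases rudinShapiro_eq_one_or k with h | h <;> simp [h]

theorem exp_fract_mul_nat (α : ℝ) (k : ℕ) :
    Complex.exp (2 * Real.pi * Complex.I * (Int.fract ((k : ℝ) * α) : ℝ))
      = Complex.exp (2 * Real.pi * Complex.I * α) ^ k := by
  rw [← Complex.exp_nat_mul, ← Complex.exp_periodic.int_mul ⌊(k : ℝ) * α⌋, Int.fract]
  push_cast
  congr 1
  ring

theorem frequently_sqrt_le_mul_starDiscrepancy {α : ℝ} (hα : α ∉ Set.range ((↑) : ℤ → ℝ)) :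
    ∃ᶠ N : ℕ in atTop, 1 / (32 * Real.pi) * √(N : ℝ)
      ≤ N * starDiscrepancy (fun n => Int.fract ((rudinShapiroInteger n : ℝ) * α)) N := by
  set z := Complex.exp (2 * Real.pi * Complex.I * α) with hzdef
  have hz : ‖z‖ = 1 := by
    have h1 : 2 * Real.pi * Complex.I * α = ((2 * Real.pi * α : ℝ) : ℂ) * Complex.I := by
      push_cast; ring
    rw [hzdef, h1, Complex.norm_exp_ofReal_mul_I]
  have hz1 : z ≠ 1 := by
    rintro h
    obtain ⟨n, hn⟩ := Complex.exp_eq_one_iff.1 h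
    rw [mul_comm] at hn
    exact hα ⟨n, by exact_mod_cast (mul_right_cancel₀ Complex.two_pi_I_ne_zero hn).symm⟩
  rw [frequently_atTop]
  intro N₀
  set C := 2 / ‖z - 1‖
  obtain ⟨m, hm⟩ := exists_nat_ge (4 * N₀ + (8 * C) ^ 2)
  obtain ⟨M, hmM, hM⟩ := exists_sqrt_le_norm_rudinShapiroSum hz m
  have hMm : (m : ℝ) ≤ M := by exact_mod_cast (Nat.lt_two_pow_self.le.trans hmM)
  set N := Nat.count (fun k => rudinShapiro k = 1) M with hN
  have hN₀ : N₀ ≤ N := by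
    refine (le_count_rudinShapiro N₀).trans (Nat.count_monotone _ ?_)
    have : (4 * N₀ : ℝ) ≤ M := by nlinarith [sq_nonneg (8 * C)]
    exact_mod_cast this
  refine ⟨N, hN₀, ?_⟩
  have hNM : √(N : ℝ) ≤ √(M : ℝ) := Real.sqrt_le_sqrt (by exact_mod_cast Nat.count_le _)
  have hC : 8 * C ≤ √(M : ℝ) := Real.le_sqrt_of_sq_le (by
    have : (0 : ℝ) ≤ N₀ := Nat.cast_nonneg _
    linarith)
  have hK := norm_sum_exp_le_mul_starDiscrepancy
    (x := fun n => Int.fract ((rudinShapiroInteger n : ℝ) * α)) (fun _ => Int.fract_nonneg _)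
    (fun _ => (Int.fract_lt_one _).le) N
  simp only [exp_fract_mul_nat] at hK
  rw [← hzdef, sum_pow_rudinShapiroInteger, norm_div, Complex.norm_ofNat] at hK
  have hG := norm_geom_sum_le hz hz1 M
  have htri := norm_sub_le_norm_add (rudinShapiroSum z M) (∑ k ∈ Finset.range M, z ^ k)
  rw [add_comm (rudinShapiroSum z M)] at htri
  rw [div_mul_eq_mul_div, one_mul, div_le_iff₀ (by positivity)]
  linarith

theorem theorem4 :
    (∃ c : ℝ, 0 < c ∧ ∀ N : ℕ, 1 ≤ N →
      c * (N : ℝ) ^ 3 ≤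
        (Finset.addEnergy (firstRudinShapiroIntegers N) (firstRudinShapiroIntegers N) : ℝ)) ∧
    (∀ᵐ α : ℝ, ∀ ε : ℝ, 0 < ε →
      IsBigOmega
        (fun N : ℕ => N * starDiscrepancy (fun n => Int.fract ((rudinShapiroInteger n : ℝ) * α)) N)
        (fun N : ℕ => (N : ℝ) ^ (1 / 2 - ε))) := by
  refine ⟨⟨1 / 8, by norm_num, fun N hN => ?_⟩, ?_⟩
  · have h : (N : ℝ) ^ 3 ≤ 8 * (Finset.addEnergy (firstRudinShapiroIntegers N)
        (firstRudinShapiroIntegers N) : ℝ) := by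
      exact_mod_cast pow_three_le_addEnergy_firstRudinShapiroIntegers hN
    linarith
  · filter_upwards [(Set.countable_range ((↑) : ℤ → ℝ)).ae_notMem volume] with α hα ε hε
    refine ⟨1 / (32 * Real.pi), by positivity, ?_⟩
    refine ((frequently_sqrt_le_mul_starDiscrepancy hα).and_eventually
      (eventually_ge_atTop 1)).mono fun N ⟨h, hN⟩ => ?_
    refine le_trans ?_ (h.trans (le_abs_self _))
    rw [abs_of_nonneg (by positivity), Real.sqrt_eq_rpow]
    refine mul_le_mul_of_nonneg_left ?_ (by positivity)
    exact Real.rpow_le_rpow_of_exponent_le (by exact_mod_cast hN) (by linarith)
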